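/- **Theorem.** Let $(M,g)$ be an $n$-dimensional smooth Riemannian manifold, let $U\subseteq M$ be open, and let $k,p\ge 0$ be integers with $k+p\ge 1$. Let $I_1,\dots,I_k,D_1,\dots,D_p\in C^\infty(U,\mathbb R)$ be functionally independent, i.e. the gradients $\nabla_g I_1(x),\dots,\nabla_g I_k(x),\nabla_g D_1(x),\dots,\nabla_g D_p(x)$ are linearly independent in $T_xM$ for every $x\in U$, and let $h_1,\dots,h_p\in C^\infty(U,\mathbb R)$. A smooth vector field $Y\in\mathfrak X(U)$ *conserves* $F\in C^\infty(U,\mathbb R)$ if $\mathcal L_YF=0$ on $U$, and *dissipates* $F$ with dissipation rate $h\in C^\infty(U,\mathbb R)$ if $\mathcal L_YF=h$ on $U$. It is called *dissipative* if there are integers $k',p'\ge 0$ with $k'+p'\ge 1$ and functions $I'_1,\dots,I'_{k'},D'_1,\dots,D'_{p'},h'_1,\dots,h'_{p'}\in C^\infty(U,\mathbb R)$ such that $Y$ conserves every $I'_j$ and dissipates every $D'_i$ with rate $h'_i$. Equip $\Lambda^qT_xM$ with the inner product determined by $\langle v_1\wedge\dots\wedge v_q,\,w_1\wedge\dots\wedge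 w_q\rangle_q=\det[g(v_i,w_j)]$ and the norm $\|\nu\|_q=\sqrt{\langle\nu,\nu\rangle_q}$. For each $x\in M$ fix an arbitrary orthonormal basis $e_1,\dots,e_n$ of $T_xM$, put $\mu=e_1\wedge\dots\wedge e_n$, and let $\star:\Lambda^qT_xM\to\Lambda^{n-q}T_xM$ be the Hodge star operator defined by $\nu\wedge\omega=\langle\star\nu,\omega\rangle_{n-q}\,\mu$ for all $\omega\in\Lambda^{n-q}T_xM$ (no dependence of the bases on $x$ is prescribed). Define on $U$ $$X_0=\Big\|\bigwedge_{i=1}^{p}\nabla_gD_i\wedge\bigwedge_{j=1}^{k}\nabla_gI_j\Big\|_{k+p}^{-2}\cdot\sum_{i=1}^{p}(-1)^{n-i}h_i\,\Theta_i,$$ $$\Theta_i=\star\Big[\bigwedge_{j=1,\,j\ne i}^{p}\nabla_gD_j\wedge\bigwedge_{l=1}^{k}\nabla_gI_l\wedge\star\Big(\bigwedge_{j=1}^{p}\nabla_gD_j\wedge\bigwedge_{l=1}^{k}\nabla_gI_l\Big)\Big],$$ where wedge products are taken in increasing order of the index, empty wedge products are $1$, and $\Lambda^1T_xM=T_xM$.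 Let $X\in\mathfrak X(U)$ be a smooth vector field which conserves $I_1,\dots,I_k,D_1,\dots,D_p$. Then the perturbed dynamical system $$\dot x=X(x)+X_0(x)$$ is generated by a (smooth) dissipative vector field $X+X_0\in\mathfrak X(U)$, which conserves $I_1,\dots,I_k$ and dissipates $D_1,\dots,D_p$ with dissipation rates $h_1,\dots,h_p$, respectively. -/

import Mathlib

open scoped Manifold ContDiff
open Bundle

noncomputable section

namespace DissipativeField

/-! ### Exterior powers of a Euclidean space and the Hodge star -/

section LinearAlgebra

variable {V : Type*} [NormedAddCommGroup V] [InnerProductSpace ℝ V]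

/-- The bilinear form on `Λ^p V` induced by the inner product of `V`. It is determined by
`⟨v₁ ∧ ⋯ ∧ v_p, w₁ ∧ ⋯ ∧ w_p⟩ = det (⟨v_i, w_j⟩)`, see `extInner_ιMulti`. -/
def extInner (V : Type*) [NormedAddCommGroup V] [InnerProductSpace ℝ V] (p : ℕ) :
    LinearMap.BilinForm ℝ (⋀[ℝ]^p V) :=
  (exteriorPower.pairingDual ℝ V p) ∘ₗ (exteriorPower.map p (innerₗ V))

theorem extInner_ιMulti {p : ℕ} (v w : Fin p → V) :
    extInner V p (exteriorPower.ιMulti ℝ p v) (exteriorPower.ιMulti ℝ p w) =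
      (Matrix.of fun i j => inner ℝ (v i) (w j)).det := by
  simp only [extInner, LinearMap.comp_apply, exteriorPower.map_apply_ιMulti,
    exteriorPower.pairingDual_ιMulti_ιMulti]
  rw [← Matrix.det_transpose]
  rfl

/-- The norm `‖ν‖_p = √⟨ν, ν⟩` on `Λ^p V`. -/
def extNorm {p : ℕ} (ν : ⋀[ℝ]^p V) : ℝ :=
  Real.sqrt (extInner V p ν ν)

/-- The wedge product `Λ^p V × Λ^q V → Λ^(p+q) V`, i.e. multiplication in the exterior algebra. -/
def wedge {p q : ℕ} (ν : ⋀[ℝ]^p V) (η : ⋀[ℝ]^q V) : ⋀[ℝ]^(p + q) V :=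
  ⟨(ν : ExteriorAlgebra ℝ V) * (η : ExteriorAlgebra ℝ V), SetLike.mul_mem_graded ν.2 η.2⟩

variable {n : ℕ}

theorem extInner_basis (e : OrthonormalBasis (Fin n) ℝ V) (p : ℕ)
    (s : Set.powersetCard (Fin n) p) :
    extInner V p (exteriorPower.ιMulti_family ℝ p e s) =
      exteriorPower.ιMultiDual ℝ p e.toBasis s := by
  have h : ∀ i, innerₗ V (e i) = e.toBasis.coord i := by
    intro i
    ext v
    simp [OrthonormalBasis.coe_toBasis_repr_apply, OrthonormalBasis.repr_apply_apply]
  have h' : (fun i => innerₗ V (e i)) = e.toBasis.coord := funext h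
  rw [extInner, LinearMap.comp_apply, exteriorPower.map_apply_ιMulti_family]
  rw [exteriorPower.ιMultiDual]
  congr 2

theorem extInner_comm {p : ℕ} (ν η : ⋀[ℝ]^p V) :
    extInner V p ν η = extInner V p η ν := by
  have h : extInner V p = (extInner V p).flip := by
    apply exteriorPower.linearMap_ext
    ext v : 1
    apply exteriorPower.linearMap_ext
    refine AlternatingMap.ext fun w => ?_
    change extInner V p _ _ = extInner V p _ _
    refine (extInner_ιMulti v w).trans (Eq.trans ?_ (extInner_ιMulti w v).symm)
    rw [← Matrix.det_transpose]
    congr 1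
    ext i j
    exact real_inner_comm _ _
  exact LinearMap.congr_fun₂ h ν η

theorem extInner_nondegenerate (e : OrthonormalBasis (Fin n) ℝ V) (p : ℕ) :
    (extInner V p).Nondegenerate := by
  have key : ∀ y : ⋀[ℝ]^p V, (∀ x, extInner V p x y = 0) → y = 0 := by
    intro y hy
    apply (e.toBasis.exteriorPower p).ext_elem
    intro s
    rw [exteriorPower.basis_repr_apply, ← extInner_basis]
    simp [hy]
  exact ⟨fun x hx => key x fun y => by rw [extInner_comm]; exact hx y, key⟩

/-- The linear functional on the exterior algebra that reads off the coefficient of the volume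
element `μ = e₁ ∧ ⋯ ∧ e_n` in the component of degree `n`, and ignores all other degrees. -/
def volCoeff (e : OrthonormalBasis (Fin n) ℝ V) : ExteriorAlgebra ℝ V →ₗ[ℝ] ℝ :=
  ExteriorAlgebra.liftAlternating (Pi.single n e.toBasis.det)

theorem eq_volCoeff_smul (e : OrthonormalBasis (Fin n) ℝ V) {x : ExteriorAlgebra ℝ V}
    (hx : x ∈ ⋀[ℝ]^n V) : x = volCoeff e x • ExteriorAlgebra.ιMulti ℝ n e := by
  rw [← ExteriorAlgebra.ιMulti_span_fixedDegree] at hx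
  induction hx using Submodule.span_induction with
  | mem x hx =>
    obtain ⟨v, rfl⟩ := hx
    rw [volCoeff, ExteriorAlgebra.liftAlternating_apply_ιMulti, Pi.single_eq_same]
    have h : ExteriorAlgebra.ιMulti ℝ n (M := V) =
        (LinearMap.toSpanSingleton ℝ _ (ExteriorAlgebra.ιMulti ℝ n e)).compAlternatingMap
          e.toBasis.det := by
      refine Module.Basis.ext_alternating e.toBasis fun i hi => ?_
      let σ : Equiv.Perm (Fin n) := Equiv.ofBijective i (Finite.injective_iff_bijective.1 hi)
      change ExteriorAlgebra.ιMulti ℝ n (e.toBasis ∘ σ) =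
        e.toBasis.det (e.toBasis ∘ σ) • ExteriorAlgebra.ιMulti ℝ n e
      rw [AlternatingMap.map_perm, AlternatingMap.map_perm, Module.Basis.det_self]
      simp
    exact congrArg (fun f => f v) h
  | zero => simp
  | add x y _ _ hx hy => rw [map_add, add_smul, ← hx, ← hy]
  | smul a x _ hx => rw [map_smul, smul_assoc, ← hx]

variable [FiniteDimensional ℝ V]

/-- The Hodge star operator `⋆ : Λ^p V → Λ^(n-p) V` associated with an orthonormal basis
`e₁, …, e_n` of `V` and the volume element `μ = e₁ ∧ ⋯ ∧ e_n`: the element `⋆ν` is the Riesz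
representative of the functional `η ↦ α_ν(η)`, where `ν ∧ η = α_ν(η) μ`. -/
def hodgeStar (e : OrthonormalBasis (Fin n) ℝ V) (p : ℕ) :
    (⋀[ℝ]^p V) →ₗ[ℝ] (⋀[ℝ]^(n - p) V) :=
  ((extInner V (n - p)).toDual (extInner_nondegenerate e (n - p))).symm.toLinearMap ∘ₗ
    ((LinearMap.mul ℝ (ExteriorAlgebra ℝ V)).compr₂ (volCoeff e)).domRestrict₁₂
      (⋀[ℝ]^p V) (⋀[ℝ]^(n - p) V)

theorem extInner_hodgeStar (e : OrthonormalBasis (Fin n) ℝ V) {p : ℕ}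
    (ν : ⋀[ℝ]^p V) (η : ⋀[ℝ]^(n - p) V) :
    extInner V (n - p) (hodgeStar e p ν) η = volCoeff e (ν * η : ExteriorAlgebra ℝ V) := by
  rw [hodgeStar, LinearMap.comp_apply, ← LinearMap.BilinForm.toDual_def
    (extInner_nondegenerate e (n - p)), LinearEquiv.coe_coe, LinearEquiv.apply_symm_apply]
  rfl

/-- The defining relation `ν ∧ η = ⟨⋆ν, η⟩ μ` of the Hodge star operator. -/
theorem mul_eq_extInner_hodgeStar_smul (e : OrthonormalBasis (Fin n) ℝ V) {p : ℕ} (hp : p ≤ n)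
    (ν : ⋀[ℝ]^p V) (η : ⋀[ℝ]^(n - p) V) :
    (ν * η : ExteriorAlgebra ℝ V) =
      extInner V (n - p) (hodgeStar e p ν) η • ExteriorAlgebra.ιMulti ℝ n e := by
  rw [extInner_hodgeStar]
  apply eq_volCoeff_smul
  have h : (ν * η : ExteriorAlgebra ℝ V) ∈ ⋀[ℝ]^(p + (n - p)) V := (wedge ν η).2
  rwa [Nat.add_sub_cancel' hp] at h

/-- The wedge product `⋀_{j ≠ i} w_j`, the factors being taken in increasing order of `j`. -/
def wedgeOmit {p : ℕ} (w : Fin p → V) (i : Fin p) : ⋀[ℝ]^(p - 1) V :=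
  exteriorPower.ιMulti ℝ (p - 1)
    (w ∘ (({i}ᶜ : Finset (Fin p)).orderEmbOfFin (by simp [Finset.card_compl])))

/-- The vector `Θ_i = ⋆[⋀_{j ≠ i} w_j ∧ ⋀_l v_l ∧ ⋆(⋀_j w_j ∧ ⋀_l v_l)]`. It has degree `1`, and
`ExteriorAlgebra.ιInv`, which inverts the inclusion `V → ExteriorAlgebra ℝ V`, turns it into an
element of `V = Λ^1 V`. -/
def theta (e : OrthonormalBasis (Fin n) ℝ V) {k p : ℕ} (w : Fin p → V) (v : Fin k → V)
    (i : Fin p) : V :=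
  ExteriorAlgebra.ιInv
    (hodgeStar e _
      (wedge (wedge (wedgeOmit w i) (exteriorPower.ιMulti ℝ k v))
        (hodgeStar e _
          (wedge (exteriorPower.ιMulti ℝ p w) (exteriorPower.ιMulti ℝ k v)))) :
      ExteriorAlgebra ℝ V)

/-- The vector `‖⋀_i w_i ∧ ⋀_j v_j‖^(-2) ∑_{i=1}^p (-1)^(n-i) c_i Θ_i`. An index `i : Fin p` stands
for the number `i + 1` of `{1, …, p}`. -/
def particularVector (e : OrthonormalBasis (Fin n) ℝ V) {k p : ℕ} (w : Fin p → V)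
    (v : Fin k → V) (c : Fin p → ℝ) : V :=
  (extNorm (wedge (exteriorPower.ιMulti ℝ p w) (exteriorPower.ιMulti ℝ k v))) ^ (-2 : ℤ) •
    ∑ i : Fin p, ((-1 : ℝ) ^ ((n : ℤ) - ((i : ℤ) + 1)) * c i) • theta e w v i

end LinearAlgebra

/-! ### Smooth functions and vector fields on an open subset of a manifold -/

section Manifold

variable {n : ℕ} {M : Type*} [TopologicalSpace M] [ChartedSpace (EuclideanSpace ℝ (Fin n)) M]

instance instFiniteDimensionalTangentSpace (x : M) : FiniteDimensional ℝ (TangentSpace (𝓡 n) x) :=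
  inferInstanceAs (FiniteDimensional ℝ (EuclideanSpace ℝ (Fin n)))

/-- `F` restricts to an element of `C^∞(U, ℝ)`, for `U` open in `M`. -/
def IsSmoothFunction (U : Set M) (F : M → ℝ) : Prop :=
  ContMDiffOn (𝓡 n) 𝓘(ℝ, ℝ) ∞ F U

/-- `X` restricts to a smooth vector field on `U`, for `U` open in `M`. -/
def IsSmoothVectorField [IsManifold (𝓡 n) ∞ M] (U : Set M) (X : ∀ x : M, TangentSpace (𝓡 n) x) : Prop :=
  ContMDiffOn (𝓡 n) (𝓡 n).tangent ∞
    (fun x => (⟨x, X x⟩ : TangentBundle (𝓡 n) M)) U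

/-- The differential `dF(x) : T_x M → ℝ`. -/
def differential (n : ℕ) {M : Type*} [TopologicalSpace M]
    [ChartedSpace (EuclideanSpace ℝ (Fin n)) M] (F : M → ℝ) (x : M) :
    TangentSpace (𝓡 n) x →L[ℝ] ℝ :=
  (NormedSpace.fromTangentSpace (𝕜 := ℝ) (F x)).toContinuousLinearMap ∘L
    mfderiv (𝓡 n) 𝓘(ℝ, ℝ) F x

/-- The Lie derivative `(L_X F)(x) = dF(x)(X(x))` of a function. -/
def lieDerivative (X : ∀ x : M, TangentSpace (𝓡 n) x) (F : M → ℝ) (x : M) : ℝ :=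
  differential n F x (X x)

/-- `X` conserves `F` on `U`: `L_X F = 0`. -/
def Conserves (U : Set M) (X : ∀ x : M, TangentSpace (𝓡 n) x) (F : M → ℝ) : Prop :=
  ∀ x ∈ U, lieDerivative X F x = 0

/-- `X` dissipates `H` on `U` with dissipation rate `h`: `L_X H = h`. -/
def Dissipates (U : Set M) (X : ∀ x : M, TangentSpace (𝓡 n) x) (H h : M → ℝ) : Prop :=
  ∀ x ∈ U, lieDerivative X H x = h x

/-- `X` is a dissipative vector field on `U`. -/
def IsDissipative [IsManifold (𝓡 n) ∞ M] (U : Set M) (X : ∀ x : M, TangentSpace (𝓡 n) x) : Prop :=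
  IsSmoothVectorField U X ∧
    ∃ (k p : ℕ) (I : Fin k → M → ℝ) (D h : Fin p → M → ℝ), 0 < k + p ∧
      (∀ j, IsSmoothFunction (n := n) U (I j)) ∧
      (∀ i, IsSmoothFunction (n := n) U (D i)) ∧
      (∀ i, IsSmoothFunction (n := n) U (h i)) ∧
      (∀ j, Conserves U X (I j)) ∧ ∀ i, Dissipates U X (D i) (h i)

variable [RiemannianBundle (fun x : M => TangentSpace (𝓡 n) x)]

/-- The Riemannian gradient: `g(∇F(x), v) = dF(x)(v)` for all `v ∈ T_x M`. -/
def grad (n : ℕ) {M : Type*} [TopologicalSpace M]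
    [ChartedSpace (EuclideanSpace ℝ (Fin n)) M]
    [RiemannianBundle (fun x : M => TangentSpace (𝓡 n) x)] (F : M → ℝ) (x : M) :
    TangentSpace (𝓡 n) x :=
  haveI : CompleteSpace (TangentSpace (𝓡 n) x) := FiniteDimensional.complete ℝ _
  (InnerProductSpace.toDual ℝ (TangentSpace (𝓡 n) x)).symm (differential n F x)

/-- `I₁, …, I_k, D₁, …, D_p` are functionally independent on `U`: their gradients are linearly
independent at every point of `U`. -/
def FunctionallyIndependent (n : ℕ) {M : Type*} [TopologicalSpace M]
    [ChartedSpace (EuclideanSpace ℝ (Fin n)) M]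
    [RiemannianBundle (fun x : M => TangentSpace (𝓡 n) x)] (U : Set M) {k p : ℕ}
    (I : Fin k → M → ℝ) (D : Fin p → M → ℝ) : Prop :=
  ∀ x ∈ U, LinearIndependent ℝ
    (Sum.elim (fun j => grad n (I j) x) (fun i => grad n (D i) x))

/-- The vector field
`X₀ = ‖⋀_i ∇D_i ∧ ⋀_j ∇I_j‖^(-2) ∑_i (-1)^(n-i) h_i Θ_i`, where
`Θ_i = ⋆[⋀_{j ≠ i} ∇D_j ∧ ⋀_l ∇I_l ∧ ⋆(⋀_j ∇D_j ∧ ⋀_l ∇I_l)]`. The Hodge star of `T_x M` is the one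
of the orthonormal basis `e x`. -/
def dissipativePerturbation (e : ∀ x : M, OrthonormalBasis (Fin n) ℝ (TangentSpace (𝓡 n) x))
    {k p : ℕ} (I : Fin k → M → ℝ) (D h : Fin p → M → ℝ) (x : M) : TangentSpace (𝓡 n) x :=
  particularVector (e x) (fun i => grad n (D i) x) (fun j => grad n (I j) x) (fun i => h i x)

end Manifold

end DissipativeField

end

/-! Write Ω for the wedge of all the gradients and Ω_i(u) for Ω with ∇D_i replaced by u. Moving u
through the wedges and using ν ∧ ⋆η = ⟨ν, η⟩ μ (`volCoeff_mul_hodgeStar`) gives ⟨Θ_i, u⟩ = ±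
⟨Ω_i(u), Ω⟩ (`inner_theta`). The prefactor (-1)^(n-i) cancels the sign, so ⟨X₀, u⟩ = ‖Ω‖⁻² ∑ h_i
⟨Ω_i(u), Ω⟩. For u a gradient, all terms with a repeated factor vanish, leaving ⟨X₀, ∇D_i⟩ = h_i and
⟨X₀, ∇I_j⟩ = 0; these are the required Lie derivatives.

Smoothness cannot be read off the formula, since the bases `e x` may vary wildly with x. But X₀ lies
in the span of the gradients (`particularVector_mem_span`) and its inner products with them are
smooth; Cramer's rule for the Gram matrix then gives smooth coefficients
(`isSmoothVectorField_of_mem_span`). -/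

namespace DissipativeField

/-! ### Exterior algebra: the Hodge star and inner products with Θ_i. -/

section LinearAlgebra

variable {V : Type*} [NormedAddCommGroup V] [InnerProductSpace ℝ V] {n : ℕ}

theorem volCoeff_ιMulti_of_eq (e : OrthonormalBasis (Fin n) ℝ V) {m : ℕ} (h : m = n)
    (w : Fin m → V) :
    volCoeff e (ExteriorAlgebra.ιMulti ℝ m w) = e.toBasis.det (w ∘ Fin.cast h.symm) := by
  subst h
  rw [volCoeff, ExteriorAlgebra.liftAlternating_apply_ιMulti, Pi.single_eq_same]
  rfl

/-- The volume coefficient of the product of two complementary basis elements is a sign. -/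
theorem volCoeff_family_mul_self (e : OrthonormalBasis (Fin n) ℝ V) {q r : ℕ} (h : q + r = n)
    {s : Set.powersetCard (Fin n) q} {t : Set.powersetCard (Fin n) r}
    (hst : Disjoint s.val t.val) :
    volCoeff e (ExteriorAlgebra.ιMulti_family ℝ q e s * ExteriorAlgebra.ιMulti_family ℝ r e t) *
      volCoeff e (ExteriorAlgebra.ιMulti_family ℝ q e s * ExteriorAlgebra.ιMulti_family ℝ r e t)
      = 1 := by
  rw [ExteriorAlgebra.ιMulti_family_mul_of_disjoint ℝ _ s t hst, ExteriorAlgebra.ιMulti_family,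
    Units.smul_def, ← Int.cast_smul_eq_zsmul ℝ, map_smul, volCoeff_ιMulti_of_eq e h]
  have hinj : Function.Injective
      (Set.powersetCard.ofFinEmbEquiv.symm (Set.powersetCard.disjUnion hst) ∘ Fin.cast h.symm) :=
    (Set.powersetCard.ofFinEmbEquiv.symm (Set.powersetCard.disjUnion hst)).injective.comp
      (Fin.cast_injective _)
  -- The disjoint union has q + r = n elements, so its enumeration is a permutation and the
  -- coefficient is a product of two signs.
  let σ : Equiv.Perm (Fin n) := Equiv.ofBijective _ (Finite.injective_iff_bijective.1 hinj)
  have hσ : (e ∘ Set.powersetCard.ofFinEmbEquiv.symm (Set.powersetCard.disjUnion hst)) ∘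
      Fin.cast h.symm = e.toBasis ∘ σ := by
    ext x
    simp [σ]
  rw [hσ, AlternatingMap.map_perm, Module.Basis.det_self]
  rcases Int.units_eq_one_or (Equiv.Perm.sign σ) with h1 | h1 <;>
  rcases Int.units_eq_one_or (Equiv.Perm.sign (Set.powersetCard.permOfDisjoint hst)) with h2 | h2 <;>
  simp [h1, h2]

theorem extInner_family (e : OrthonormalBasis (Fin n) ℝ V) (q : ℕ)
    (s t : Set.powersetCard (Fin n) q) :
    extInner V q (exteriorPower.ιMulti_family ℝ q e s) (exteriorPower.ιMulti_family ℝ q e t) =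
      if s = t then 1 else 0 := by
  rw [extInner_basis, ← e.coe_toBasis]
  split_ifs with h
  · rw [h, exteriorPower.ιMultiDual_apply_diag]
  · rw [exteriorPower.ιMultiDual_apply_nondiag _ _ _ _ _ h]

/-- By cardinality, the complement is the only index set of size r disjoint from `s`; any other
shares a factor with it. -/
theorem family_mul_of_ne_compl {q r : ℕ} (h : r + q = Fintype.card (Fin n)) (b : Fin n → V)
    {s : Set.powersetCard (Fin n) q} {t : Set.powersetCard (Fin n) r}
    (hst : Set.powersetCard.compl h s ≠ t) :
    (exteriorPower.ιMulti_family ℝ q b s : ExteriorAlgebra ℝ V) *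
      (exteriorPower.ιMulti_family ℝ r b t : ExteriorAlgebra ℝ V) = 0 := by
  apply ExteriorAlgebra.ιMulti_family_mul_of_not_disjoint
  intro hd
  obtain ⟨i, hi, hit⟩ := (Set.powersetCard.exists_mem_notMem_iff_ne _ _).1 hst.symm
  rw [Set.powersetCard.mem_compl, not_not] at hit
  exact Finset.disjoint_left.1 hd hit hi

/-- The Hodge star of a basis element of `Λ^q V` is a signed complementary basis element. -/
theorem hodgeStar_family [FiniteDimensional ℝ V] (e : OrthonormalBasis (Fin n) ℝ V) {q : ℕ}
    (h : n - q + q = Fintype.card (Fin n)) (s : Set.powersetCard (Fin n) q) :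
    hodgeStar e q (exteriorPower.ιMulti_family ℝ q e s) =
      volCoeff e ((exteriorPower.ιMulti_family ℝ q e s : ExteriorAlgebra ℝ V) *
        (exteriorPower.ιMulti_family ℝ (n - q) e (Set.powersetCard.compl h s) :
          ExteriorAlgebra ℝ V)) •
      exteriorPower.ιMulti_family ℝ (n - q) e (Set.powersetCard.compl h s) := by
  apply LinearMap.ker_eq_bot.1 (LinearMap.BilinForm.Nondegenerate.ker_eq_bot
    (extInner_nondegenerate e (n - q)))
  apply (e.toBasis.exteriorPower (n - q)).ext
  intro t
  rw [exteriorPower.basis_apply, e.coe_toBasis, extInner_hodgeStar, map_smul, LinearMap.smul_apply,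
    extInner_family]
  split_ifs with ht
  · rw [ht, smul_eq_mul, mul_one]
  · rw [family_mul_of_ne_compl h e ht, map_zero, smul_zero]

/-- The relation `ν ∧ ⋆η = ⟨ν, η⟩ μ`. -/
theorem volCoeff_mul_hodgeStar [FiniteDimensional ℝ V] (e : OrthonormalBasis (Fin n) ℝ V)
    {q : ℕ} (hq : q ≤ n) (ν η : ⋀[ℝ]^q V) :
    volCoeff e (ν * hodgeStar e q η : ExteriorAlgebra ℝ V) = extInner V q ν η := by
  have h : n - q + q = Fintype.card (Fin n) := by simp [hq]
  have key : ((LinearMap.mul ℝ (ExteriorAlgebra ℝ V)).compr₂ (volCoeff e)).compl₁₂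
      (⋀[ℝ]^q V).subtype ((⋀[ℝ]^(n - q) V).subtype ∘ₗ hodgeStar e q) = extInner V q := by
    apply (e.toBasis.exteriorPower q).ext
    intro s
    apply (e.toBasis.exteriorPower q).ext
    intro t
    simp only [exteriorPower.basis_apply, e.coe_toBasis]
    rw [extInner_family]
    change volCoeff e (_ * (hodgeStar e q _ : ExteriorAlgebra ℝ V)) = _
    rw [hodgeStar_family e h, Submodule.coe_smul, mul_smul_comm, map_smul, smul_eq_mul]
    -- On the diagonal the sign of (s, sᶜ) occurs twice, once from the star and once from the
    -- product, hence squares to 1.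
    split_ifs with hst
    · subst hst
      apply volCoeff_family_mul_self e (Nat.add_sub_cancel' hq)
      rw [Set.powersetCard.coe_compl]
      exact disjoint_compl_right
    · change _ * volCoeff e ((exteriorPower.ιMulti_family ℝ q e s : ExteriorAlgebra ℝ V) * _) = 0
      rw [family_mul_of_ne_compl h e (s := s)
        (fun h' => hst ((Set.powersetCard.compl h).injective h')), map_zero, mul_zero]
  exact LinearMap.congr_fun₂ key ν η

theorem mul_ι_eq {m : ℕ} {x : ExteriorAlgebra ℝ V} (hx : x ∈ ⋀[ℝ]^m V) (u : V) :
    x * ExteriorAlgebra.ι ℝ u = (-1 : ℝ) ^ m • (ExteriorAlgebra.ι ℝ u * x) := by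
  rw [← ExteriorAlgebra.ιMulti_span_fixedDegree] at hx
  induction hx using Submodule.span_induction with
  | mem x hx =>
    obtain ⟨v, rfl⟩ := hx
    induction m with
    | zero => simp
    | succ m ih =>
      rw [ExteriorAlgebra.ιMulti_succ_apply, mul_assoc, ih, mul_smul_comm, ← mul_assoc, ← mul_assoc,
        eq_neg_of_add_eq_zero_left (ExteriorAlgebra.ι_add_mul_swap (R := ℝ) (v 0) u), pow_succ,
        neg_mul, smul_neg, mul_neg_one, neg_smul]
  | zero => simp
  | add x y _ _ hx hy => rw [add_mul, hx, hy, mul_add, smul_add]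
  | smul a x _ hx => rw [smul_mul_assoc, hx, mul_smul_comm, smul_comm]

/-- The degree is a variable `N` because the degree arising in `theta` equals 1 only
propositionally. -/
theorem inner_ιInv {N : ℕ} (hN : N = 1) (ν η : ⋀[ℝ]^N V) (u : V)
    (hη : (η : ExteriorAlgebra ℝ V) = ExteriorAlgebra.ι ℝ u) :
    inner ℝ (ExteriorAlgebra.ιInv (ν : ExteriorAlgebra ℝ V)) u = extInner V N ν η := by
  subst hN
  obtain ⟨y, hy⟩ : ∃ y, ExteriorAlgebra.ι ℝ y = (ν : ExteriorAlgebra ℝ V) := by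
    have := ν.2
    change _ ∈ LinearMap.range (ExteriorAlgebra.ι ℝ) ^ 1 at this
    rwa [pow_one] at this
  have hι : ∀ z : V, ((exteriorPower.ιMulti ℝ 1 fun _ => z : ⋀[ℝ]^1 V) : ExteriorAlgebra ℝ V) =
      ExteriorAlgebra.ι ℝ z := fun z => by
    simp [ExteriorAlgebra.ιMulti_apply]
  have h1 : ν = exteriorPower.ιMulti ℝ 1 fun _ => y := Subtype.ext (by rw [hι, hy])
  have h2 : η = exteriorPower.ιMulti ℝ 1 fun _ => u := Subtype.ext (by rw [hι, hη])
  rw [← hy, ExteriorAlgebra.ι_leftInverse, h1, h2, extInner_ιMulti]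
  simp

theorem wedgeOmit_eq {p : ℕ} (w : Fin (p + 1) → V) (i : Fin (p + 1)) :
    (wedgeOmit w i : ExteriorAlgebra ℝ V) =
      ExteriorAlgebra.ιMulti ℝ p (fun j => w (i.succAbove j)) := by
  have : ∀ h, (({i}ᶜ : Finset (Fin (p + 1))).orderEmbOfFin h) =
      (i.succAboveOrderEmb : Fin p ↪o Fin (p + 1)) := by
    intro h
    symm
    apply Finset.orderEmbOfFin_unique'
    intro x
    simp [Fin.succAbove_ne]
  rw [wedgeOmit, exteriorPower.ιMulti_apply_coe]
  change ExteriorAlgebra.ιMulti ℝ p _ = _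
  congr 1
  ext j
  exact congrArg w (congrArg (fun f => f j) (this _))

/-- Moving the last factor `u` of `⋀_{j ≠ i} w_j ∧ ⋀_l v_l ∧ u` to the `i`-th place. -/
theorem wedgeOmit_mul_ι {k p : ℕ} (w : Fin p → V) (v : Fin k → V) (i : Fin p) (u : V) :
    (wedgeOmit w i : ExteriorAlgebra ℝ V) * ExteriorAlgebra.ιMulti ℝ k v *
        ExteriorAlgebra.ι ℝ u =
      (-1 : ℝ) ^ (p - 1 + k + i) •
        (ExteriorAlgebra.ιMulti ℝ p (Function.update w i u) * ExteriorAlgebra.ιMulti ℝ k v) := by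
  obtain _ | p := p
  · exact i.elim0
  have hmem := SetLike.mul_mem_graded (A := fun m => ⋀[ℝ]^m V) (wedgeOmit w i).2
    (exteriorPower.ιMulti ℝ k v).2
  rw [exteriorPower.ιMulti_apply_coe] at hmem
  rw [mul_ι_eq hmem, ← mul_assoc, wedgeOmit_eq, pow_add _ (p + 1 - 1 + k), mul_smul]
  congr 1
  -- `u` now stands in front; moving it past the first i factors into slot i costs the remaining
  -- sign (-1)^i.
  have h1 : Function.update w i u = i.insertNth (α := fun _ => V) u (fun j => w (i.succAbove j)) := by
    exact (Fin.insertNth_removeNth i u w).symm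
  rw [h1, AlternatingMap.map_insertNth, ExteriorAlgebra.ιMulti_succ_apply]
  rw [← Int.cast_smul_eq_zsmul ℝ, smul_mul_assoc, smul_smul]
  simp [← mul_pow]

theorem append_eq_elim_comp {α : Type*} {k p : ℕ} (w : Fin p → α) (v : Fin k → α) :
    Fin.append w v = Sum.elim w v ∘ finSumFinEquiv.symm := by
  ext x
  refine Fin.addCases (fun _ => ?_) (fun _ => ?_) x <;> simp

variable {k p : ℕ}

theorem wedge_ιMulti_ιMulti (w : Fin p → V) (v : Fin k → V) :
    wedge (exteriorPower.ιMulti ℝ p w) (exteriorPower.ιMulti ℝ k v) =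
      exteriorPower.ιMulti ℝ (p + k) (Fin.append w v) :=
  Subtype.ext (ExteriorAlgebra.ιMulti_mul_ιMulti w v)

/-- Pairing with u turns the outer star into the volume coefficient of ⋀_{j ≠ i} w_j ∧ ⋀ v_l ∧ ⋆Ω ∧
u. The two signs come from moving u leftwards past ⋆Ω and then into slot i; what remains is a
product with ⋆Ω, that is, an inner product with Ω. -/
theorem inner_theta [FiniteDimensional ℝ V] (e : OrthonormalBasis (Fin n) ℝ V) (hn : p + k ≤ n)
    (w : Fin p → V) (v : Fin k → V) (i : Fin p) (u : V) :
    inner ℝ (theta e w v i) u = (-1 : ℝ) ^ (n - (p + k)) * (-1 : ℝ) ^ (p - 1 + k + i) *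
      extInner V (p + k)
        (exteriorPower.ιMulti ℝ (p + k) (Fin.append (Function.update w i u) v))
        (exteriorPower.ιMulti ℝ (p + k) (Fin.append w v)) := by
  have hp := i.pos
  have hdeg : n - (p - 1 + k + (n - (p + k))) = 1 := by omega
  have hmem : ExteriorAlgebra.ι ℝ u ∈ ⋀[ℝ]^(n - (p - 1 + k + (n - (p + k)))) V := by
    rw [hdeg]
    change _ ∈ LinearMap.range (ExteriorAlgebra.ι ℝ) ^ 1
    rw [pow_one]
    exact ⟨u, rfl⟩
  rw [theta, inner_ιInv hdeg _ ⟨_, hmem⟩ u rfl, extInner_hodgeStar]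
  set Ω := wedge (exteriorPower.ιMulti ℝ p w) (exteriorPower.ιMulti ℝ k v) with hΩ
  change volCoeff e ((wedgeOmit w i : ExteriorAlgebra ℝ V) * ExteriorAlgebra.ιMulti ℝ k v *
    hodgeStar e (p + k) Ω * ExteriorAlgebra.ι ℝ u) = _
  rw [mul_assoc, mul_ι_eq (hodgeStar e (p + k) Ω).2, mul_smul_comm, ← mul_assoc,
    wedgeOmit_mul_ι, smul_mul_assoc, map_smul, map_smul, smul_eq_mul, smul_eq_mul, ← mul_assoc,
    ExteriorAlgebra.ιMulti_mul_ιMulti]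
  congr 1
  rw [wedge_ιMulti_ιMulti] at hΩ
  rw [← exteriorPower.ιMulti_apply_coe, volCoeff_mul_hodgeStar e hn, hΩ]

/-- ‖Ω‖² is the Gram determinant of the family, positive by linear independence. -/
theorem extNorm_zpow_mul (w : Fin p → V) (v : Fin k → V)
    (hlin : LinearIndependent ℝ (Sum.elim v w)) :
    extNorm (wedge (exteriorPower.ιMulti ℝ p w) (exteriorPower.ιMulti ℝ k v)) ^ (-2 : ℤ) *
      extInner V (p + k) (exteriorPower.ιMulti ℝ (p + k) (Fin.append w v))
        (exteriorPower.ιMulti ℝ (p + k) (Fin.append w v)) = 1 := by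
  have h : LinearIndependent ℝ (Fin.append w v) := by
    rw [append_eq_elim_comp, linearIndependent_equiv, ← linearIndependent_equiv (Equiv.sumComm _ _)]
    convert hlin using 1
    ext (x | x) <;> rfl
  have hpos := (Matrix.posDef_gram_of_linearIndependent (𝕜 := ℝ) h).det_pos
  rw [wedge_ιMulti_ιMulti, extNorm, extInner_ιMulti]
  change Real.sqrt (Matrix.gram ℝ (Fin.append w v)).det ^ (-2 : ℤ) *
    (Matrix.gram ℝ (Fin.append w v)).det = 1
  rw [zpow_neg, zpow_ofNat, Real.sq_sqrt hpos.le, inv_mul_cancel₀ hpos.ne']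

variable [FiniteDimensional ℝ V]

theorem le_of_linearIndependent_elim (e : OrthonormalBasis (Fin n) ℝ V) {w : Fin p → V}
    {v : Fin k → V} (hlin : LinearIndependent ℝ (Sum.elim v w)) : p + k ≤ n := by
  have := hlin.fintype_card_le_finrank
  rwa [Fintype.card_sum, Fintype.card_fin, Fintype.card_fin,
    Module.finrank_eq_card_basis e.toBasis, Fintype.card_fin, add_comm] at this

theorem inner_particularVector (e : OrthonormalBasis (Fin n) ℝ V) {w : Fin p → V} {v : Fin k → V}
    (c : Fin p → ℝ) (hn : p + k ≤ n) (u : V) :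
    inner ℝ (particularVector e w v c) u =
      ∑ i, c i * (extNorm (wedge (exteriorPower.ιMulti ℝ p w) (exteriorPower.ιMulti ℝ k v)) ^
        (-2 : ℤ) * extInner V (p + k)
        (exteriorPower.ιMulti ℝ (p + k) (Fin.append (Function.update w i u) v))
        (exteriorPower.ιMulti ℝ (p + k) (Fin.append w v))) := by
  rw [particularVector, real_inner_smul_left, sum_inner, Finset.mul_sum]
  refine Finset.sum_congr rfl fun i _ => ?_
  have hsign : (-1 : ℝ) ^ ((n : ℤ) - ((i : ℤ) + 1)) *
      ((-1 : ℝ) ^ (n - (p + k)) * (-1 : ℝ) ^ (p - 1 + k + i)) = 1 := by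
    have hp := i.pos
    rw [← zpow_natCast, ← zpow_natCast, ← zpow_add₀ (by norm_num), ← zpow_add₀ (by norm_num)]
    apply Even.neg_one_zpow
    -- The three exponents add up to 2(n - 1).
    exact ⟨n - 1, by omega⟩
  rw [real_inner_smul_left, inner_theta e hn]
  linear_combination (c i * extNorm (wedge (exteriorPower.ιMulti ℝ p w)
    (exteriorPower.ιMulti ℝ k v)) ^ (-2 : ℤ) * extInner V (p + k)
        (exteriorPower.ιMulti ℝ (p + k) (Fin.append (Function.update w i u) v))
        (exteriorPower.ιMulti ℝ (p + k) (Fin.append w v))) * hsign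

theorem inner_particularVector_left (e : OrthonormalBasis (Fin n) ℝ V) {w : Fin p → V}
    {v : Fin k → V} (hlin : LinearIndependent ℝ (Sum.elim v w)) (c : Fin p → ℝ) (i : Fin p) :
    inner ℝ (particularVector e w v c) (w i) = c i := by
  rw [inner_particularVector e c (le_of_linearIndependent_elim e hlin), Finset.sum_eq_single i]
  · rw [Function.update_eq_self, extNorm_zpow_mul w v hlin, mul_one]
  · intro j _ hj
    -- For j ≠ i the vector `w i` fills both slots i and j.
    rw [AlternatingMap.map_eq_zero_of_eq _ _ (i := Fin.castAdd k i) (j := Fin.castAdd k j)]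
    · simp
    · simp [Function.update_of_ne hj.symm]
    · simpa using hj.symm
  · simp

theorem inner_particularVector_right (e : OrthonormalBasis (Fin n) ℝ V) {w : Fin p → V}
    {v : Fin k → V} (hlin : LinearIndependent ℝ (Sum.elim v w)) (c : Fin p → ℝ) (j : Fin k) :
    inner ℝ (particularVector e w v c) (v j) = 0 := by
  rw [inner_particularVector e c (le_of_linearIndependent_elim e hlin)]
  refine Finset.sum_eq_zero fun i _ => ?_
  rw [AlternatingMap.map_eq_zero_of_eq _ _ (i := Fin.castAdd k i) (j := Fin.natAdd p j)]
  · simp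
  · simp
  · intro h
    have := congrArg Fin.val h
    simp at this
    omega

/-- If u is orthogonal to the whole family, row i of the determinant ⟨Ω_i(u), Ω⟩ vanishes; hence the
vector lies in the double orthogonal complement of the span. -/
theorem particularVector_mem_span (e : OrthonormalBasis (Fin n) ℝ V) {w : Fin p → V}
    {v : Fin k → V} (hlin : LinearIndependent ℝ (Sum.elim v w)) (c : Fin p → ℝ) :
    particularVector e w v c ∈ Submodule.span ℝ (Set.range (Sum.elim v w)) := by
  rw [← Submodule.orthogonal_orthogonal (Submodule.span ℝ _), Submodule.mem_orthogonal']
  intro u hu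
  have hu' : ∀ a, inner ℝ u (Sum.elim v w a) = 0 := fun a =>
    (Submodule.mem_orthogonal' _ _).1 hu _ (Submodule.subset_span ⟨a, rfl⟩)
  rw [inner_particularVector e c (le_of_linearIndependent_elim e hlin)]
  refine Finset.sum_eq_zero fun i _ => ?_
  rw [extInner_ιMulti, Matrix.det_eq_zero_of_row_eq_zero (Fin.castAdd k i), mul_zero, mul_zero]
  intro b
  refine Fin.addCases (fun b => ?_) (fun b => ?_) b
  · simpa using hu' (Sum.inr b)
  · simpa using hu' (Sum.inl b)

end LinearAlgebra

open Matrix in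
/-- Cramer's rule for the coordinates of a vector in the span of a linearly independent family. -/
theorem eq_sum_cramer_gram_smul {V ι : Type*} [NormedAddCommGroup V] [InnerProductSpace ℝ V]
    [Fintype ι] [DecidableEq ι] {s : ι → V} (hs : LinearIndependent ℝ s) {y : V}
    (hy : y ∈ Submodule.span ℝ (Set.range s)) :
    y = ∑ a, (((Matrix.gram ℝ s).updateCol a fun b => inner ℝ (s b) y).det /
      (Matrix.gram ℝ s).det) • s a := by
  obtain ⟨c, rfl⟩ := (Submodule.mem_span_range_iff_exists_fun ℝ).1 hy
  refine Finset.sum_congr rfl fun a _ => ?_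
  have hdet : (Matrix.gram ℝ s).det ≠ 0 := Matrix.det_gram_ne_zero_iff_linearIndependent.2 hs
  have hc : (fun b => inner ℝ (s b) (∑ a, c a • s a)) = Matrix.gram ℝ s *ᵥ c := by
    ext b
    simp [Matrix.mulVec, dotProduct, inner_sum, real_inner_smul_right, mul_comm]
  rw [hc, ← Matrix.cramer_apply, Matrix.cramer_eq_adjugate_mulVec, Matrix.mulVec_mulVec,
    Matrix.adjugate_mul, Matrix.smul_mulVec, Matrix.one_mulVec, Pi.smul_apply, smul_eq_mul,
    mul_div_cancel_left₀ _ hdet]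

/-! ### Smoothness of Lie derivatives, gradients and fields in a span. -/

section Manifold

variable {n : ℕ} {M : Type*} [TopologicalSpace M] [ChartedSpace (EuclideanSpace ℝ (Fin n)) M]
  {U : Set M}

theorem IsSmoothFunction.det {ι : Type*} [Fintype ι] [DecidableEq ι] {A : M → Matrix ι ι ℝ}
    (hA : ∀ a b, IsSmoothFunction (n := n) U fun x => A x a b) :
    IsSmoothFunction (n := n) U fun x => (A x).det := by
  simp only [Matrix.det_apply, Units.smul_def, ← Int.cast_smul_eq_zsmul ℝ, smul_eq_mul]
  exact contMDiffOn_finsetSum fun σ _ => contMDiffOn_const.mul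
    (contMDiffOn_finsetProd fun a _ => hA _ _)

theorem inner_grad [RiemannianBundle (fun x : M => TangentSpace (𝓡 n) x)]
    (F : M → ℝ) (x : M) (v : TangentSpace (𝓡 n) x) :
    inner ℝ (grad n F x) v = differential n F x v := by
  have : CompleteSpace (TangentSpace (𝓡 n) x) := FiniteDimensional.complete ℝ _
  exact InnerProductSpace.toDual_symm_apply

theorem lieDerivative_add_apply [RiemannianBundle (fun x : M => TangentSpace (𝓡 n) x)]
    (X Y : ∀ x : M, TangentSpace (𝓡 n) x) (F : M → ℝ) (x : M) :
    lieDerivative (fun x => X x + Y x) F x = lieDerivative X F x + inner ℝ (Y x) (grad n F x) := by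
  rw [real_inner_comm, inner_grad, lieDerivative, map_add]
  rfl

variable [IsManifold (𝓡 n) ∞ M]

/-- The Lie derivative of a smooth function along a smooth vector field is smooth. -/
theorem IsSmoothVectorField.isSmoothFunction_lieDerivative (hU : IsOpen U)
    {X : ∀ x : M, TangentSpace (𝓡 n) x} (hX : IsSmoothVectorField U X) {F : M → ℝ}
    (hF : IsSmoothFunction (n := n) U F) :
    IsSmoothFunction (n := n) U (lieDerivative X F) := by
  have h1 : ContMDiffOn (𝓡 n).tangent 𝓘(ℝ, ℝ).tangent ∞
      (tangentMapWithin (𝓡 n) 𝓘(ℝ, ℝ) F U) (Bundle.TotalSpace.proj ⁻¹' U) :=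
    ContMDiffOn.contMDiffOn_tangentMapWithin hF (by simp) hU.uniqueMDiffOn
  -- The tangent map of F composed with X has the Lie derivative as its fibre component.
  have h2 := h1.comp hX (fun x hx => hx)
  intro x hx
  have h3 := h2 x hx
  rw [contMDiffWithinAt_totalSpace] at h3
  refine h3.2.congr ?_ ?_
  · intro y hy
    simp [lieDerivative, differential, tangentMapWithin, mfderivWithin_of_isOpen hU hy]
    rfl
  · simp [lieDerivative, differential, tangentMapWithin, mfderivWithin_of_isOpen hU hx]
    rfl

theorem IsSmoothVectorField.add {X Y : ∀ x : M, TangentSpace (𝓡 n) x}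
    (hX : IsSmoothVectorField U X) (hY : IsSmoothVectorField U Y) :
    IsSmoothVectorField U (fun x => X x + Y x) :=
  ContMDiffOn.add_section hX hY

variable [RiemannianBundle (fun x : M => TangentSpace (𝓡 n) x)]
  [IsContMDiffRiemannianBundle (𝓡 n) ∞ (EuclideanSpace ℝ (Fin n))
      (fun x : M => TangentSpace (𝓡 n) x)]

/-- A vector field in the span of a linearly independent family of smooth vector fields is smooth
if its inner products with the members of the family are. -/
theorem isSmoothVectorField_of_mem_span {ι : Type*} [Fintype ι]
    {s : ι → ∀ x : M, TangentSpace (𝓡 n) x} (hs : ∀ a, IsSmoothVectorField U (s a))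
    (hlin : ∀ x ∈ U, LinearIndependent ℝ fun a => s a x)
    {Y : ∀ x : M, TangentSpace (𝓡 n) x}
    (hspan : ∀ x ∈ U, Y x ∈ Submodule.span ℝ (Set.range fun a => s a x))
    (hY : ∀ a, IsSmoothFunction (n := n) U fun x => inner ℝ (s a x) (Y x)) :
    IsSmoothVectorField U Y := by
  classical
  have hG : ∀ a b, IsSmoothFunction (n := n) U
      fun x => Matrix.gram ℝ (fun a => s a x) a b := fun a b =>
    ContMDiffOn.inner_bundle (hs a) (hs b)
  have hcoeff : ∀ a, IsSmoothFunction (n := n) U fun x =>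
      ((Matrix.gram ℝ fun a => s a x).updateCol a fun b => inner ℝ (s b x) (Y x)).det /
        (Matrix.gram ℝ fun a => s a x).det := by
    intro a
    refine ContMDiffOn.div₀ (IsSmoothFunction.det fun b c => ?_) (IsSmoothFunction.det hG)
      fun x hx => Matrix.det_gram_ne_zero_iff_linearIndependent.2 (hlin x hx)
    simp only [Matrix.updateCol_apply]
    split_ifs
    · exact hY b
    · exact hG b c
  refine ContMDiffOn.congr (ContMDiffOn.sum_section (s := Finset.univ)
    fun a _ => ContMDiffOn.smul_section (hcoeff a) (hs a)) fun x hx => ?_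
  exact congrArg (TotalSpace.mk x) (eq_sum_cramer_gram_smul (hlin x hx) (hspan x hx))

/-- The gradient of a smooth function is a smooth vector field. -/
theorem IsSmoothFunction.isSmoothVectorField_grad (hU : IsOpen U) {F : M → ℝ}
    (hF : IsSmoothFunction (n := n) U F) : IsSmoothVectorField U (grad n F) := by
  intro x hx
  let t := trivializationAt (EuclideanSpace ℝ (Fin n)) (TangentSpace (𝓡 n) (M := M)) x
  let b := (EuclideanSpace.basisFun (Fin n) ℝ).toBasis
  have hframe := t.isLocalFrameOn_localFrame_baseSet (𝓡 n) ∞ b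
  have hW : IsOpen (U ∩ t.baseSet) := hU.inter t.open_baseSet
  have hs : ∀ a, IsSmoothVectorField (U ∩ t.baseSet) (t.localFrame b a) := fun a =>
    (hframe.contMDiffOn a).mono Set.inter_subset_right
  have h : IsSmoothVectorField (U ∩ t.baseSet) (grad n F) := by
    -- A local frame spans every tangent space, and the inner product of ∇F with a frame field is
    -- the derivative of F along that field.
    refine isSmoothVectorField_of_mem_span hs (fun y hy => hframe.linearIndependent hy.2)
      (fun y hy => hframe.generating hy.2 trivial) fun a => ?_
    simp only [real_inner_comm (grad n F _), inner_grad]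
    exact (hs a).isSmoothFunction_lieDerivative hW (hF.mono Set.inter_subset_left)
  exact (h.contMDiffAt (hW.mem_nhds
    ⟨hx, FiberBundle.mem_baseSet_trivializationAt' x⟩)).contMDiffWithinAt

end Manifold

end DissipativeField

/-! ### The main theorem. -/

theorem theorem4p2 {n k p : ℕ} {M : Type*} [TopologicalSpace M]
    [ChartedSpace (EuclideanSpace ℝ (Fin n)) M] [IsManifold (𝓡 n) ∞ M]
    [RiemannianBundle (fun x : M => TangentSpace (𝓡 n) x)]
    [IsContMDiffRiemannianBundle (𝓡 n) ∞ (EuclideanSpace ℝ (Fin n))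
      (fun x : M => TangentSpace (𝓡 n) x)]
    (hkp : 0 < k + p)
    (e : ∀ x : M, OrthonormalBasis (Fin n) ℝ (TangentSpace (𝓡 n) x))
    (U : Set M) (hU : IsOpen U)
    (I : Fin k → M → ℝ) (D h : Fin p → M → ℝ)
    (hI : ∀ j, DissipativeField.IsSmoothFunction (n := n) U (I j))
    (hD : ∀ i, DissipativeField.IsSmoothFunction (n := n) U (D i))
    (hh : ∀ i, DissipativeField.IsSmoothFunction (n := n) U (h i))
    (hind : DissipativeField.FunctionallyIndependent n U I D)
    (X : ∀ x : M, TangentSpace (𝓡 n) x)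
    (hX : DissipativeField.IsSmoothVectorField U X)
    (hXI : ∀ j, DissipativeField.Conserves U X (I j))
    (hXD : ∀ i, DissipativeField.Conserves U X (D i)) :
    DissipativeField.IsDissipative U
        (fun x => X x + DissipativeField.dissipativePerturbation e I D h x) ∧
      (∀ j, DissipativeField.Conserves U
        (fun x => X x + DissipativeField.dissipativePerturbation e I D h x) (I j)) ∧
      ∀ i, DissipativeField.Dissipates U
        (fun x => X x + DissipativeField.dissipativePerturbation e I D h x) (D i) (h i) := by
  have hleft : ∀ x ∈ U, ∀ i, inner ℝ (DissipativeField.dissipativePerturbation e I D h x)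
      (DissipativeField.grad n (D i) x) = h i x := fun x hx i =>
    DissipativeField.inner_particularVector_left (e x) (hind x hx) (fun i => h i x) i
  have hright : ∀ x ∈ U, ∀ j, inner ℝ (DissipativeField.dissipativePerturbation e I D h x)
      (DissipativeField.grad n (I j) x) = 0 := fun x hx j =>
    DissipativeField.inner_particularVector_right (e x) (hind x hx) (fun i => h i x) j
  have hsmooth : DissipativeField.IsSmoothVectorField U
      (DissipativeField.dissipativePerturbation e I D h) := by
    have helim : ∀ x, (fun a => Sum.elim (fun j => DissipativeField.grad n (I j))
        (fun i => DissipativeField.grad n (D i)) a x) =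
        Sum.elim (fun j => DissipativeField.grad n (I j) x)
          (fun i => DissipativeField.grad n (D i) x) := by
      intro x
      ext1 (a | a) <;> rfl
    refine DissipativeField.isSmoothVectorField_of_mem_span
      (s := Sum.elim (fun j => DissipativeField.grad n (I j))
        (fun i => DissipativeField.grad n (D i))) ?_ ?_ ?_ ?_
    · rintro (j | i)
      · exact (hI j).isSmoothVectorField_grad hU
      · exact (hD i).isSmoothVectorField_grad hU
    · intro x hx
      rw [helim]
      exact hind x hx
    · intro x hx
      rw [helim]
      exact DissipativeField.particularVector_mem_span (e x) (hind x hx) _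
    -- The inner products with the gradients are 0 and h_i, smooth whatever the choice of `e`.
    · rintro (j | i)
      · refine ContMDiffOn.congr (f := fun _ => (0 : ℝ)) contMDiffOn_const fun x hx => ?_
        rw [real_inner_comm]
        exact hright x hx j
      · refine ContMDiffOn.congr (hh i) fun x hx => ?_
        rw [real_inner_comm]
        exact hleft x hx i
  have hcons : ∀ j, DissipativeField.Conserves U
      (fun x => X x + DissipativeField.dissipativePerturbation e I D h x) (I j) := fun j x hx => by
    rw [DissipativeField.lieDerivative_add_apply, hXI j x hx, hright x hx, add_zero]
  have hdiss : ∀ i, DissipativeField.Dissipates U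
      (fun x => X x + DissipativeField.dissipativePerturbation e I D h x) (D i) (h i) :=
    fun i x hx => by
    rw [DissipativeField.lieDerivative_add_apply, hXD i x hx, hleft x hx, zero_add]
  exact ⟨⟨hX.add hsmooth, k, p, I, D, h, hkp, hI, hD, hh, hcons, hdiss⟩, hcons, hdiss⟩
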